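/- \textbf{Corollary (Lipschitz functionals on Sobolev spaces).} Let $D\subset\mathbb R^d$ be a compact set with non-empty interior, let $s>0$ be real and $1\le p\le\infty$. Write $W^{s,p}(D)$ and $L^p(D)$ for the spaces of real-valued functions $W^{s,p}(\Omega)$ and $L^p(\Omega)$ on the interior $\Omega$ of $D$. Here, with $m=\lfloor s\rfloor$ and $\sigma=s-m$, the space $W^{s,p}(\Omega)$ consists of the $u\in L^p(\Omega)$ that have weak derivatives $D^\alpha u$, $|\alpha|\le m$, and for which $$\|u\|_{W^{s,p}}=\Big(\sum_{|\alpha|\le m}\|D^\alpha u\|_{L^p(\Omega)}^p+\sum_{|\alpha|=m}[D^\alpha u]_{\sigma,p}^p\Big)^{1/p}<\infty ,\qquad [g]_{\sigma,p}^p=\int_\Omega\int_\Omega\frac{|g(x)-g(y)|^p}{|x-y|^{d+\sigma p}}\,dx\,dy ,$$ where the second sum is absent if $s$ is an integer; if $p=\infty$, the sums are replaced by maxima and $[g]_{\sigma,\infty}=\operatorname{ess\,sup}_{x,y\in\Omega}|g(x)-g(y)|/|x-y|^\sigma$. Let $$\mathcal K=\{u\in W^{s,p}(D):\|u\|_{W^{s,p}}\le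 1\},$$ considered as a subset of $L^p(D)$ with the metric of the $L^p$-norm, and let $\mathrm{Lip}_1(\mathcal K)$ be the set of all $\mathcal G:\mathcal K\to\mathbb R$ with $|\mathcal G(u)|\le 1$ and $|\mathcal G(u)-\mathcal G(v)|\le\|u-v\|_{L^p(D)}$ for all $u,v\in\mathcal K$. Let $\mathcal H(\mathrm{Lip}_1(\mathcal K);\epsilon)=\log_2 N\in[0,\infty]$, where $N$ is the smallest number of closed sup-norm balls of radius $\epsilon$, centred at bounded continuous functions on $\mathcal K$, that cover $\mathrm{Lip}_1(\mathcal K)$ ($N=\infty$ if there is no finite cover). Then there are constants $c>0$ and $\epsilon_0>0$, depending only on $d,D,s,p$, such that $$\mathcal H(\mathrm{Lip}_1(\mathcal K);\epsilon)\ \ge\ \exp\!\big(c\,\epsilon^{-d/s}\big)\qquad\text{for all }\epsilon\in(0,\epsilon_0].$$ -/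

import Mathlib

open MeasureTheory Set
open scoped ENNReal NNReal ContDiff BoundedContinuousFunction

noncomputable section

/-- The covering entropy `log₂ N(A; ε)` of a subset `A` of a metric space `V`, where `N(A; ε)` is the
smallest number of closed balls of radius `ε`, with centres anywhere in `V`, that cover `A`.
It is an extended real number: it is `⊤` if no finite number of balls suffices. -/
def metricEntropy {V : Type*} [MetricSpace V] (A : Set V) (ε : ℝ≥0) : EReal :=
  ENNReal.log ((Metric.externalCoveringNumber ε A : ℕ∞) : ℝ≥0∞) / ((Real.log 2 : ℝ) : EReal)

/-- `Lip₁(X)`: all `G : X → ℝ` with `sup |G| ≤ 1` and Lipschitz constant at most `1`, as a subset of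
the space of bounded continuous functions with the sup-norm (which is `C(X)` if `X` is compact). -/
def lipOne (X : Type*) [MetricSpace X] : Set (X →ᵇ ℝ) :=
  {G | (∀ u, |G u| ≤ 1) ∧ ∀ u v, |G u - G v| ≤ dist u v}

/-- The `i`-th partial derivative of a function on `ℝᵈ`. -/
def partialD {d : ℕ} (i : Fin d) (φ : EuclideanSpace ℝ (Fin d) → ℝ) :
    EuclideanSpace ℝ (Fin d) → ℝ :=
  fun x => fderiv ℝ φ x (EuclideanSpace.single i 1)

/-- The classical derivative `D^α φ = ∂₁^{α₁} ⋯ ∂_d^{α_d} φ` for a multi-index `α`. -/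
def multiD {d : ℕ} (α : Fin d → ℕ) (φ : EuclideanSpace ℝ (Fin d) → ℝ) :
    EuclideanSpace ℝ (Fin d) → ℝ :=
  (List.finRange d).foldr (fun i ψ => (partialD i)^[α i] ψ) φ

/-- `g` is the weak derivative `D^α u` of `u` on the open set `Ω`. -/
def IsWeakDeriv {d : ℕ} (Ω : Set (EuclideanSpace ℝ (Fin d))) (α : Fin d → ℕ)
    (u g : EuclideanSpace ℝ (Fin d) → ℝ) : Prop :=
  LocallyIntegrableOn u Ω ∧ LocallyIntegrableOn g Ω ∧
    ∀ φ : EuclideanSpace ℝ (Fin d) → ℝ, ContDiff ℝ ∞ φ → HasCompactSupport φ → tsupport φ ⊆ Ω →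
      ∫ x in Ω, u x * multiD α φ x = (-1) ^ (∑ i, α i) * ∫ x in Ω, g x * φ x

/-- The multi-indices `α ∈ ℕᵈ` of length `|α| = k`. -/
def multiIdx (d k : ℕ) : Finset (Fin d → ℕ) := Finset.univ.piAntidiag k

/-- The Gagliardo–Slobodeckij seminorm of order `σ ∈ (0,1)`,
`(∫_Ω ∫_Ω |g x - g y|ᵖ / |x - y|^{d + σ p} dx dy)^{1/p}` for `p < ∞` and the essential supremum of
`|g x - g y| / |x - y|^σ` for `p = ∞`, written as one `Lᵖ(Ω × Ω)`-norm. -/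
def slobodeckij {d : ℕ} (Ω : Set (EuclideanSpace ℝ (Fin d))) (σ : ℝ) (p : ℝ≥0∞)
    (g : EuclideanSpace ℝ (Fin d) → ℝ) : ℝ≥0∞ :=
  eLpNorm (fun z : EuclideanSpace ℝ (Fin d) × EuclideanSpace ℝ (Fin d) =>
      (g z.1 - g z.2) / ‖z.1 - z.2‖ ^ (((d : ℝ≥0∞) / p).toReal + σ)) p
    ((volume.restrict Ω).prod (volume.restrict Ω))

/-- With `s = m + σ`, `m = ⌊s⌋`, the `W^{s,p}(Ω)`-norm computed from a family `g` of weak derivatives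
`g α = D^α u`, `|α| ≤ m`:
`(∑_{|α| ≤ m} ‖D^α u‖ₚᵖ + ∑_{|α| = m} [D^α u]_{σ,p}ᵖ)^{1/p}`, with maxima in place of sums if
`p = ∞`; the second sum is present only if `s` is not an integer. -/
def sobolevNormOf {d : ℕ} (Ω : Set (EuclideanSpace ℝ (Fin d))) (s : ℝ) (p : ℝ≥0∞)
    (g : (Fin d → ℕ) → EuclideanSpace ℝ (Fin d) → ℝ) : ℝ≥0∞ :=
  let m := ⌊s⌋₊
  let σ := s - m
  let semi : (Fin d → ℕ) → ℝ≥0∞ := fun α => if σ = 0 then 0 else slobodeckij Ω σ p (g α)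
  if p = ⊤ then
    max (⨆ k ∈ Finset.range (m + 1), ⨆ α ∈ multiIdx d k, eLpNorm (g α) p (volume.restrict Ω))
      (⨆ α ∈ multiIdx d m, semi α)
  else
    ((∑ k ∈ Finset.range (m + 1), ∑ α ∈ multiIdx d k,
        eLpNorm (g α) p (volume.restrict Ω) ^ p.toReal) +
      ∑ α ∈ multiIdx d m, semi α ^ p.toReal) ^ (1 / p.toReal)

/-- The `W^{s,p}(Ω)`-norm of `u`, for `Ω` open; it is `∞` if `u` is not in `W^{s,p}(Ω)`.
Weak derivatives are unique almost everywhere, so that the infimum is over at most one value. -/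
def sobolevNorm {d : ℕ} (Ω : Set (EuclideanSpace ℝ (Fin d))) (s : ℝ) (p : ℝ≥0∞)
    (u : EuclideanSpace ℝ (Fin d) → ℝ) : ℝ≥0∞ :=
  ⨅ (g : (Fin d → ℕ) → EuclideanSpace ℝ (Fin d) → ℝ)
    (_ : ∀ α : Fin d → ℕ, ∑ i, α i ≤ ⌊s⌋₊ → IsWeakDeriv Ω α u (g α)), sobolevNormOf Ω s p g

/-- The unit ball of `W^{s,p}(D)` as a subset of `Lᵖ(D)`, for a set `D ⊆ ℝᵈ`; functions on `D` are
understood on the interior of `D`. -/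
def sobolevUnitBall {d : ℕ} (D : Set (EuclideanSpace ℝ (Fin d))) (s : ℝ) (p : ℝ≥0∞) :
    Set (Lp ℝ p (volume.restrict (interior D))) :=
  {u | sobolevNorm (interior D) s p u ≤ 1}

end

/-! Two exponentials are stacked. Write `K` for the unit ball of `W^{s,p}` with the `Lᵖ` metric.

Outer layer (`two_pow_card_le_externalCoveringNumber_lipOne`): if `S ⊆ K` is finite and
`t`-separated with `2ε < t ≤ 1`, then the functions `min(t, dist(·, A))`, `A ⊆ S`, lie in `Lip₁(K)`
and are pairwise at sup-distance at least `t`. No ball of radius `ε` contains two of these `2^|S|`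
functions, so the entropy of `Lip₁(K)` is at least `|S|`: the entropy of the functionals is bounded
below by a packing number of `K`, not by its logarithm.

Inner layer (`exists_separated_sobolevUnitBall`): place `M^d` bumps of width `h ~ 1/M` and height `~
h^s` with disjoint supports in a ball inside `D`. Every sum of a subfamily has `W^{s,p}`-norm at
most `1` (`exists_sobolevNorm_superpose_le_one`). By the Varshamov–Gilbert bound
(`exists_separated_code`) there are at least `r^(M^d)` subfamilies, `r > 1`, any two of which differ
in at least an eighth of the bumps; the corresponding sums are `Lᵖ`-separated by a constant times
`h^s`. Taking `h^s ~ ε` makes `M^d ~ ε^{-d/s}`. -/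

/-! ### Binary codes with large Hamming distance -/

/-- The number of subsets of `ι` with at most `n / 8` elements, `n = card ι`. -/
theorem card_small_finsets_le (ι : Type*) [Fintype ι] [DecidableEq ι] :
    (((Finset.univ : Finset (Finset ι)).filter
        fun A => 8 * A.card ≤ Fintype.card ι).card : ℝ) ≤
      (9 / 8 * 8 ^ (1 / 8 : ℝ)) ^ Fintype.card ι := by
  set n := Fintype.card ι
  have h1 : ∑ A : Finset ι, (1 / 8 : ℝ) ^ A.card = (9 / 8) ^ n := by
    have := Finset.sum_pow_mul_eq_add_pow (1 / 8 : ℝ) 1 (Finset.univ : Finset ι)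
    simp only [Finset.powerset_univ, one_pow, mul_one, Finset.card_univ] at this
    rw [this]; norm_num [n]
  have h8 : (1 : ℝ) ≤ 8 ^ (1 / 8 : ℝ) := Real.one_le_rpow (by norm_num) (by norm_num)
  have h8' : ((8 : ℝ) ^ (1 / 8 : ℝ)) ^ 8 = 8 := by
    rw [← Real.rpow_natCast, ← Real.rpow_mul (by norm_num)]; norm_num
  -- Chernoff weighting: for `8|A| ≤ n` the factor `8^{n/8}` compensates `(1/8)^|A|`, so the count
  -- is at most `8^{n/8}` times the full binomial sum `(9/8)^n`.
  have h2 : ∀ A ∈ (Finset.univ : Finset (Finset ι)).filter fun A => 8 * A.card ≤ n,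
      (1 : ℝ) ≤ (1 / 8) ^ A.card * (8 ^ (1 / 8 : ℝ)) ^ n := by
    intro A hA
    have hA' : 8 * A.card ≤ n := (Finset.mem_filter.1 hA).2
    calc (1 : ℝ) = (1 / 8) ^ A.card * (((8 : ℝ) ^ (1 / 8 : ℝ)) ^ 8) ^ A.card := by
          rw [h8', ← mul_pow]; norm_num
      _ ≤ _ := by
          rw [← pow_mul]
          gcongr
  calc _ = ∑ A ∈ (Finset.univ : Finset (Finset ι)).filter fun A => 8 * A.card ≤ n, (1 : ℝ) := by
        simp
    _ ≤ ∑ A ∈ (Finset.univ : Finset (Finset ι)).filter fun A => 8 * A.card ≤ n,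
        (1 / 8) ^ A.card * (8 ^ (1 / 8 : ℝ)) ^ n := Finset.sum_le_sum h2
    _ ≤ ∑ A : Finset ι, (1 / 8) ^ A.card * (8 ^ (1 / 8 : ℝ)) ^ n :=
        Finset.sum_le_sum_of_subset_of_nonneg (Finset.filter_subset _ _)
          fun _ _ _ => by positivity
    _ = _ := by rw [← Finset.sum_mul, h1, mul_pow]

/-- The Varshamov–Gilbert bound. -/
theorem exists_separated_code (ι : Type*) [Fintype ι] [DecidableEq ι] :
    ∃ S : Finset (Finset ι),
      (∀ A ∈ S, ∀ B ∈ S, A ≠ B → Fintype.card ι ≤ 8 * (symmDiff A B).card) ∧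
      (2 / (9 / 8 * 8 ^ (1 / 8 : ℝ)) : ℝ) ^ Fintype.card ι ≤ S.card := by
  classical
  set n := Fintype.card ι
  let F : Finset (Finset (Finset ι)) := Finset.univ.filter fun S =>
    ∀ A ∈ S, ∀ B ∈ S, A ≠ B → n ≤ 8 * (symmDiff A B).card
  obtain ⟨S, hS, hmax⟩ := F.exists_max_image Finset.card ⟨∅, by simp [F]⟩
  have hS' := (Finset.mem_filter.1 hS).2
  refine ⟨S, hS', ?_⟩
  -- A code of maximal size also covers: a set farther than `n/8` from all of `S` could be added to
  -- it.
  have hcov : ∀ C : Finset ι, ∃ A ∈ S, 8 * (symmDiff A C).card ≤ n := by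
    intro C
    by_contra! hC
    have hCS : C ∉ S := fun h => by simpa using hC C h
    have : insert C S ∈ F := by
      refine Finset.mem_filter.2 ⟨Finset.mem_univ _, ?_⟩
      intro A hA B hB hAB
      rcases Finset.mem_insert.1 hA with h | h <;> rcases Finset.mem_insert.1 hB with h' | h'
      · exact absurd (h.trans h'.symm) hAB
      · rw [symmDiff_comm, h]; exact (hC B h').le
      · rw [h']; exact (hC A h).le
      · exact hS' A h B h' hAB
    have := hmax _ this
    rw [Finset.card_insert_of_notMem hCS] at this
    omega
  let B := (Finset.univ : Finset (Finset ι)).filter fun A => 8 * A.card ≤ n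
  have hsurj : (Finset.univ : Finset (Finset ι)) ⊆
      (S ×ˢ B).image fun q => symmDiff q.1 q.2 := by
    intro C _
    obtain ⟨A, hA, hAC⟩ := hcov C
    refine Finset.mem_image.2 ⟨(A, symmDiff A C), ?_, by simp⟩
    simp [hA, B, hAC]
  have hcard : 2 ^ n ≤ S.card * B.card := by
    have := (Finset.card_le_card hsurj).trans Finset.card_image_le
    simpa [Finset.card_product, n] using this
  have hB : (B.card : ℝ) ≤ (9 / 8 * 8 ^ (1 / 8 : ℝ)) ^ n := card_small_finsets_le ι
  rw [div_pow, div_le_iff₀ (by positivity)]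
  calc (2 : ℝ) ^ n ≤ S.card * B.card := by exact_mod_cast hcard
    _ ≤ _ := by gcongr

theorem one_lt_code_rate : (1 : ℝ) < 2 / (9 / 8 * 8 ^ (1 / 8 : ℝ)) := by
  have h0 : (0 : ℝ) < 8 ^ (1 / 8 : ℝ) := by positivity
  have h8' : ((8 : ℝ) ^ (1 / 8 : ℝ)) ^ 8 = 8 := by
    rw [← Real.rpow_natCast, ← Real.rpow_mul (by norm_num)]; norm_num
  rw [lt_div_iff₀ (by positivity), one_mul]
  -- In eighth powers the claim is `(9/8)^8 · 8 < 2^8`.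
  refine lt_of_pow_lt_pow_left₀ 8 (by norm_num) ?_
  rw [mul_pow, h8']
  norm_num

/-! ### Entropy of Lipschitz functionals and packings of the domain -/

/-- The truncated distance to a set; it is constant for the empty set. -/
noncomputable def truncDist {X : Type*} [MetricSpace X] (t : ℝ) (A : Set X) (x : X) : ℝ :=
  open Classical in if A.Nonempty then min t (Metric.infDist x A) else t

theorem truncDist_nonneg {X : Type*} [MetricSpace X] {t : ℝ} (ht : 0 ≤ t) (A : Set X) (x : X) :
    0 ≤ truncDist t A x := by
  unfold truncDist
  split_ifs
  · exact le_min ht Metric.infDist_nonneg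
  · exact ht

theorem truncDist_le {X : Type*} [MetricSpace X] (t : ℝ) (A : Set X) (x : X) :
    truncDist t A x ≤ t := by
  unfold truncDist
  split_ifs
  · exact min_le_left _ _
  · exact le_rfl

theorem abs_truncDist_sub_le {X : Type*} [MetricSpace X] (t : ℝ) (A : Set X) (x y : X) :
    |truncDist t A x - truncDist t A y| ≤ dist x y := by
  unfold truncDist
  split_ifs
  · refine (abs_min_sub_min_le_max _ _ _ _).trans (max_le (by simp) ?_)
    have := (Metric.lipschitz_infDist_pt A).dist_le_mul x y
    simpa [Real.dist_eq] using this
  · simp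

theorem truncDist_of_mem {X : Type*} [MetricSpace X] {t : ℝ} (ht : 0 ≤ t) {A : Set X} {x : X}
    (hx : x ∈ A) : truncDist t A x = 0 := by
  have : A.Nonempty := ⟨x, hx⟩
  simp [truncDist, this, Metric.infDist_zero_of_mem hx, ht]

theorem truncDist_of_separated {X : Type*} [MetricSpace X] {t : ℝ} {A : Set X} {x : X}
    (hx : ∀ y ∈ A, t ≤ dist x y) : truncDist t A x = t := by
  unfold truncDist
  split_ifs with h
  · exact min_eq_left ((Metric.le_infDist h).2 fun {y} hy => hx y hy)
  · rfl

/-- `truncDist` as a bounded continuous function. -/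
noncomputable def truncDistBCF {X : Type*} [MetricSpace X] (t : ℝ) (A : Set X) : X →ᵇ ℝ :=
  BoundedContinuousFunction.mkOfBound
    ⟨truncDist t A, (LipschitzWith.of_dist_le_mul (K := 1) fun x y => by
      simpa [Real.dist_eq] using abs_truncDist_sub_le t A x y).continuous⟩ |t| (fun x y => by
      have h0 := le_abs_self t
      have h1 := truncDist_le t A x
      have h2 := truncDist_le t A y
      have h3 : 0 ≤ t ∨ t < 0 := le_or_gt 0 t
      rcases h3 with h3 | h3
      · have := truncDist_nonneg h3 A x
        have := truncDist_nonneg h3 A y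
        simp only [ContinuousMap.coe_mk, Real.dist_eq, abs_le]
        constructor <;> linarith
      · have hx : ∀ z, truncDist t A z = t := fun z => by
          unfold truncDist
          split_ifs
          · exact min_eq_left (h3.le.trans Metric.infDist_nonneg)
          · rfl
        simp [hx])

/-- At a point `x ∈ A \ B` the truncated distance to `A` is `0`, while that to `B` is `t` because
`S` is `t`-separated. Truncation at `t ≤ 1` keeps the functions within the bound `1` and gives `A =
∅` a meaning. The inequality `2ε < t` is strict because separation in the packing number is strict.
-/
theorem two_pow_card_le_externalCoveringNumber_lipOne {X : Type*} [MetricSpace X] {ε t : ℝ≥0}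
    (hεt : 2 * ε < t) (ht : t ≤ 1) (S : Finset X)
    (hS : ∀ x ∈ S, ∀ y ∈ S, x ≠ y → (t : ℝ) ≤ dist x y) :
    ((2 ^ S.card : ℕ) : ℕ∞) ≤ Metric.externalCoveringNumber ε (lipOne X) := by
  classical
  refine le_trans ?_ (Metric.packingNumber_two_mul_le_externalCoveringNumber ε _)
  let f : Finset X → (X →ᵇ ℝ) := fun A => truncDistBCF (t : ℝ) (A : Set X)
  have key : ∀ A ∈ S.powerset, ∀ B ∈ S.powerset, ∀ x ∈ A, x ∉ B →
      (t : ℝ) ≤ dist (f A) (f B) := by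
    intro A hA B hB x hxA hxB
    refine le_trans ?_ (BoundedContinuousFunction.dist_coe_le_dist x)
    have h1 : f A x = 0 := truncDist_of_mem t.2 (by simpa using hxA)
    have h2 : f B x = t := truncDist_of_separated fun y hy => by
      have hy' : y ∈ B := by simpa using hy
      exact hS x (Finset.mem_powerset.1 hA hxA) y (Finset.mem_powerset.1 hB hy')
        (fun h => hxB (h ▸ hy'))
    rw [h1, h2]; simp
  have key' : ∀ A ∈ S.powerset, ∀ B ∈ S.powerset, A ≠ B → (t : ℝ) ≤ dist (f A) (f B) := by
    intro A hA B hB hAB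
    by_cases h : A ⊆ B
    · obtain ⟨x, hxB, hxA⟩ := Finset.not_subset.1 fun h' => hAB (h.antisymm h')
      rw [dist_comm]
      exact key B hB A hA x hxB hxA
    · obtain ⟨x, hxA, hxB⟩ := Finset.not_subset.1 h
      exact key A hA B hB x hxA hxB
  have ht0 : (0 : ℝ) < t := by
    have : 0 < t := lt_of_le_of_lt (zero_le) hεt
    exact_mod_cast this
  have hinj : Set.InjOn f S.powerset := by
    intro A hA B hB hAB
    by_contra h
    have := key' A (by simpa using hA) B (by simpa using hB) h
    rw [hAB, dist_self] at this
    linarith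
  have hsep : Metric.IsSeparated ((2 * ε : ℝ≥0) : ℝ≥0∞) (f '' (S.powerset : Set (Finset X))) := by
    rintro _ ⟨A, hA, rfl⟩ _ ⟨B, hB, rfl⟩ hAB
    have h := key' A hA B hB fun h => hAB (by rw [h])
    rw [edist_nndist, ENNReal.coe_lt_coe]
    refine hεt.trans_le ?_
    exact_mod_cast h
  have hsub : f '' (S.powerset : Set (Finset X)) ⊆ lipOne X := by
    rintro _ ⟨A, -, rfl⟩
    refine ⟨fun u => ?_, fun u v => abs_truncDist_sub_le _ _ _ _⟩
    have h1 := truncDist_nonneg t.coe_nonneg (A : Set X) u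
    have h2 := truncDist_le (t : ℝ) (A : Set X) u
    have h3 : (t : ℝ) ≤ 1 := by exact_mod_cast ht
    change |truncDist _ _ _| ≤ 1
    rw [abs_of_nonneg h1]
    exact h2.trans h3
  have := hsep.encard_le_packingNumber hsub
  rwa [hinj.encard_image, Set.encard_coe_eq_coe_finsetCard, Finset.card_powerset] at this

theorem card_le_metricEntropy_lipOne {X : Type*} [MetricSpace X] {ε t : ℝ≥0}
    (hεt : 2 * ε < t) (ht : t ≤ 1) (S : Finset X)
    (hS : ∀ x ∈ S, ∀ y ∈ S, x ≠ y → (t : ℝ) ≤ dist x y) :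
    ((S.card : ℝ) : EReal) ≤ metricEntropy (lipOne X) ε := by
  have h := two_pow_card_le_externalCoveringNumber_lipOne hεt ht S hS
  unfold metricEntropy
  have hlog : (0 : ℝ) < Real.log 2 := Real.log_pos (by norm_num)
  rw [EReal.le_div_iff_mul_le (by exact_mod_cast hlog) (EReal.coe_ne_top _)]
  have h' : ((2 : ℝ≥0∞) ^ S.card) ≤
      ((Metric.externalCoveringNumber ε (lipOne X) : ℕ∞) : ℝ≥0∞) := by
    have := ENat.toENNReal_le.2 h
    simpa using this
  refine le_trans (le_of_eq ?_) (ENNReal.log_le_log h')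
  rw [ENNReal.log_pow]
  have : ENNReal.log 2 = ((Real.log 2 : ℝ) : EReal) := by
    have := ENNReal.log_ofReal_of_pos (x := 2) (by norm_num)
    simpa using this
  rw [this]
  norm_cast

/-! ### Smooth functions and their weak derivatives -/

/-- The derivative `∂_d^{α_d} ⋯ ∂₁^{α₁} φ`, with the factors in the order opposite to `multiD`. -/
noncomputable def revMultiD {d : ℕ} (α : Fin d → ℕ) (φ : EuclideanSpace ℝ (Fin d) → ℝ) :
    EuclideanSpace ℝ (Fin d) → ℝ :=
  (List.finRange d).foldl (fun ψ i => (partialD i)^[α i] ψ) φ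

section Derivatives

variable {d : ℕ}

theorem ContDiff.partialD {φ : EuclideanSpace ℝ (Fin d) → ℝ} (hφ : ContDiff ℝ ∞ φ) (i : Fin d) :
    ContDiff ℝ ∞ (partialD i φ) :=
  (hφ.fderiv_right (m := ∞) (by simp)).clm_apply contDiff_const

theorem tsupport_partialD_subset (φ : EuclideanSpace ℝ (Fin d) → ℝ) (i : Fin d) :
    tsupport (partialD i φ) ⊆ tsupport φ :=
  (closure_mono fun x hx => by
    simp only [Function.mem_support] at hx ⊢
    intro h
    exact hx (by simp [partialD, h])).trans (tsupport_fderiv_subset ℝ (f := φ))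

/-- A property of functions that is stable under partial derivatives is stable under `multiD`. -/
theorem multiD_induction {P : (EuclideanSpace ℝ (Fin d) → ℝ) → Prop}
    (hP : ∀ φ i, P φ → P (partialD i φ)) (α : Fin d → ℕ) (l : List (Fin d))
    {φ : EuclideanSpace ℝ (Fin d) → ℝ} (hφ : P φ) :
    P (l.foldr (fun i ψ => (partialD i)^[α i] ψ) φ) := by
  induction l with
  | nil => exact hφ
  | cons i l ih => exact Function.Iterate.rec P ih (hP · i) (α i)

theorem revMultiD_induction {P : (EuclideanSpace ℝ (Fin d) → ℝ) → Prop}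
    (hP : ∀ φ i, P φ → P (partialD i φ)) (α : Fin d → ℕ) {φ : EuclideanSpace ℝ (Fin d) → ℝ}
    (hφ : P φ) : P (revMultiD α φ) := by
  unfold revMultiD
  induction List.finRange d generalizing φ with
  | nil => exact hφ
  | cons i l ih => exact ih (Function.Iterate.rec P hφ (hP · i) (α i))

/-- Smooth functions with closed support in `K`. -/
def SmoothSupportedIn (K : Set (EuclideanSpace ℝ (Fin d))) (φ : EuclideanSpace ℝ (Fin d) → ℝ) :
    Prop :=
  ContDiff ℝ ∞ φ ∧ tsupport φ ⊆ K

theorem SmoothSupportedIn.partialD {K : Set (EuclideanSpace ℝ (Fin d))}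
    {φ : EuclideanSpace ℝ (Fin d) → ℝ} (hφ : SmoothSupportedIn K φ) (i : Fin d) :
    SmoothSupportedIn K (partialD i φ) :=
  ⟨hφ.1.partialD i, (tsupport_partialD_subset φ i).trans hφ.2⟩

theorem SmoothSupportedIn.hasCompactSupport {K : Set (EuclideanSpace ℝ (Fin d))}
    {φ : EuclideanSpace ℝ (Fin d) → ℝ} (hφ : SmoothSupportedIn K φ) (hK : IsCompact K) :
    HasCompactSupport φ :=
  hK.of_isClosed_subset (isClosed_tsupport φ) hφ.2

theorem integral_mul_partialD {K : Set (EuclideanSpace ℝ (Fin d))} (hK : IsCompact K)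
    {u φ : EuclideanSpace ℝ (Fin d) → ℝ} (hu : ContDiff ℝ ∞ u) (hφ : SmoothSupportedIn K φ)
    (i : Fin d) : ∫ x, u x * partialD i φ x = -∫ x, partialD i u x * φ x := by
  have hc := hφ.hasCompactSupport hK
  have hc' := (hφ.partialD i).hasCompactSupport hK
  refine integral_mul_fderiv_eq_neg_fderiv_mul_of_integrable ?_ ?_ ?_ ?_ ?_
  · exact ((hu.partialD i).continuous.mul hφ.1.continuous).integrable_of_hasCompactSupport
      hc.mul_left
  · exact (hu.continuous.mul (hφ.1.partialD i).continuous).integrable_of_hasCompactSupport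
      hc'.mul_left
  · exact (hu.continuous.mul hφ.1.continuous).integrable_of_hasCompactSupport hc.mul_left
  · exact fun x _ => (hu.differentiable (by simp)).differentiableAt
  · exact fun x _ => (hφ.1.differentiable (by simp)).differentiableAt

theorem integral_mul_iterate_partialD {K : Set (EuclideanSpace ℝ (Fin d))} (hK : IsCompact K)
    {u φ : EuclideanSpace ℝ (Fin d) → ℝ} (hu : ContDiff ℝ ∞ u) (hφ : SmoothSupportedIn K φ)
    (i : Fin d) (k : ℕ) :
    ∫ x, u x * (partialD i)^[k] φ x = (-1) ^ k * ∫ x, (partialD i)^[k] u x * φ x := by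
  induction k generalizing u with
  | zero => simp
  | succ k ih =>
    have h : SmoothSupportedIn K ((partialD i)^[k] φ) :=
      Function.Iterate.rec (SmoothSupportedIn K) hφ (fun _ h => h.partialD i) k
    rw [Function.iterate_succ_apply', integral_mul_partialD hK hu h, ih (hu.partialD i),
      ← Function.iterate_succ_apply]
    ring

/-- Integration by parts moves the outermost derivative of `φ` first, and it becomes the innermost
one on `u`. Hence the reversed order in `revMultiD`, which avoids any appeal to the symmetry of
mixed derivatives. -/
theorem integral_mul_multiD {K : Set (EuclideanSpace ℝ (Fin d))} (hK : IsCompact K)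
    {u φ : EuclideanSpace ℝ (Fin d) → ℝ} (hu : ContDiff ℝ ∞ u) (hφ : SmoothSupportedIn K φ)
    (α : Fin d → ℕ) :
    ∫ x, u x * multiD α φ x = (-1) ^ (∑ i, α i) * ∫ x, revMultiD α u x * φ x := by
  rw [Fin.sum_univ_def]
  unfold multiD revMultiD
  induction List.finRange d generalizing u with
  | nil => simp
  | cons i l ih =>
    have h := multiD_induction (P := SmoothSupportedIn K) (fun _ i h => h.partialD i) α l hφ
    have hu' : ContDiff ℝ ∞ ((partialD i)^[α i] u) :=
      Function.Iterate.rec (ContDiff ℝ ∞) hu (fun _ h => h.partialD i) (α i)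
    simp only [List.foldr_cons, List.foldl_cons, List.map_cons, List.sum_cons]
    rw [integral_mul_iterate_partialD hK hu h, ih hu']
    ring

/-- The function `v` stands for the chosen representative of an `Lᵖ` class, which agrees with the
smooth `u` only almost everywhere. Since test functions are supported in `Ω`, there are no boundary
terms. -/
theorem isWeakDeriv_revMultiD {Ω : Set (EuclideanSpace ℝ (Fin d))} {u v : EuclideanSpace ℝ (Fin d) → ℝ} (hu : ContDiff ℝ ∞ u)
    (hvu : v =ᵐ[volume.restrict Ω] u) (hv : LocallyIntegrableOn v Ω) (α : Fin d → ℕ) :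
    IsWeakDeriv Ω α v (revMultiD α u) := by
  have hu' : ContDiff ℝ ∞ (revMultiD α u) :=
    revMultiD_induction (P := ContDiff ℝ ∞) (fun _ i h => h.partialD i) α hu
  refine ⟨hv, hu'.continuous.locallyIntegrable.locallyIntegrableOn Ω, ?_⟩
  intro φ hφ hc hsub
  have h : SmoothSupportedIn (tsupport φ) φ := ⟨hφ, subset_rfl⟩
  have h' : tsupport (multiD α φ) ⊆ tsupport φ :=
    (multiD_induction (P := SmoothSupportedIn (tsupport φ)) (fun _ i h => h.partialD i) α _ h).2
  have e1 : ∫ x in Ω, v x * multiD α φ x = ∫ x in Ω, u x * multiD α φ x :=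
    integral_congr_ae (hvu.mono fun x hx => by simp only [hx])
  rw [e1, setIntegral_eq_integral_of_forall_compl_eq_zero, integral_mul_multiD hc hu h,
    setIntegral_eq_integral_of_forall_compl_eq_zero]
  · intro x hx
    rw [image_eq_zero_of_notMem_tsupport fun hx' => hx (hsub hx'), mul_zero]
  · intro x hx
    rw [image_eq_zero_of_notMem_tsupport fun hx' => hx (hsub (h' hx')), mul_zero]

end Derivatives

/-! ### Sums of disjoint rescaled bumps -/

section Superposition

variable {d : ℕ} {ι : Type*} [Fintype ι]

/-- The superposition `∑ₖ ηₖ ψ((x - cₖ) / h)` of rescaled translates of `ψ`. -/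
noncomputable def superpose (h : ℝ) (c : ι → EuclideanSpace ℝ (Fin d)) (η : ι → ℝ)
    (ψ : EuclideanSpace ℝ (Fin d) → ℝ) (x : EuclideanSpace ℝ (Fin d)) : ℝ :=
  ∑ k, η k * ψ (h⁻¹ • (x - c k))

theorem ContDiff.superpose {ψ : EuclideanSpace ℝ (Fin d) → ℝ} (hψ : ContDiff ℝ ∞ ψ)
    (h : ℝ) (c : ι → EuclideanSpace ℝ (Fin d)) (η : ι → ℝ) :
    ContDiff ℝ ∞ (superpose h c η ψ) := by
  unfold _root_.superpose
  fun_prop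

theorem partialD_const_mul_superpose {ψ : EuclideanSpace ℝ (Fin d) → ℝ} (hψ : ContDiff ℝ ∞ ψ)
    (h : ℝ) (c : ι → EuclideanSpace ℝ (Fin d)) (η : ι → ℝ) (a : ℝ) (i : Fin d) :
    partialD i (fun x => a * superpose h c η ψ x) =
      fun x => a * h⁻¹ * superpose h c η (partialD i ψ) x := by
  ext x
  have hd : ∀ y, HasFDerivAt ψ (fderiv ℝ ψ y) y := fun y =>
    ((hψ.differentiable (by simp)) y).hasFDerivAt
  have h1 : ∀ k, HasFDerivAt (fun x => ψ (h⁻¹ • (x - c k)))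
      ((fderiv ℝ ψ (h⁻¹ • (x - c k))).comp
        (h⁻¹ • ContinuousLinearMap.id ℝ (EuclideanSpace ℝ (Fin d)))) x := fun k =>
    (hd _).comp x (((hasFDerivAt_id x).sub_const (c k)).const_smul h⁻¹)
  have h2 : HasFDerivAt (fun x => a * superpose h c η ψ x)
      (a • ∑ k, η k • ((fderiv ℝ ψ (h⁻¹ • (x - c k))).comp
        (h⁻¹ • ContinuousLinearMap.id ℝ (EuclideanSpace ℝ (Fin d))))) x :=
    (HasFDerivAt.fun_sum fun k _ => (h1 k).const_mul (η k)).const_mul a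
  rw [partialD, h2.fderiv]
  simp only [superpose, partialD, smul_apply, sum_apply,
    ContinuousLinearMap.comp_apply, ContinuousLinearMap.id_apply, map_smul, smul_eq_mul,
    Finset.mul_sum]
  exact Finset.sum_congr rfl fun k _ => by ring

theorem revMultiD_const_mul_superpose {ψ : EuclideanSpace ℝ (Fin d) → ℝ} (hψ : ContDiff ℝ ∞ ψ)
    (h : ℝ) (c : ι → EuclideanSpace ℝ (Fin d)) (η : ι → ℝ) (a : ℝ) (α : Fin d → ℕ) :
    revMultiD α (fun x => a * superpose h c η ψ x) =
      fun x => a * h⁻¹ ^ (∑ i, α i) * superpose h c η (revMultiD α ψ) x := by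
  have step : ∀ (i : Fin d) (k : ℕ) (a : ℝ) {ψ : EuclideanSpace ℝ (Fin d) → ℝ},
      ContDiff ℝ ∞ ψ → (partialD i)^[k] (fun x => a * superpose h c η ψ x) =
        fun x => a * h⁻¹ ^ k * superpose h c η ((partialD i)^[k] ψ) x := by
    intro i k
    induction k with
    | zero => intro a ψ _; simp
    | succ k ih =>
      intro a ψ hψ
      rw [Function.iterate_succ_apply, partialD_const_mul_superpose hψ, ih _ (hψ.partialD i),
        ← Function.iterate_succ_apply]
      ext x
      ring
  rw [Fin.sum_univ_def]
  unfold revMultiD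
  induction List.finRange d generalizing ψ a with
  | nil => simp
  | cons i l ih =>
    have hψ' : ContDiff ℝ ∞ ((partialD i)^[α i] ψ) :=
      Function.Iterate.rec (ContDiff ℝ ∞) hψ (fun _ h => h.partialD i) (α i)
    simp only [List.foldl_cons, List.map_cons, List.sum_cons]
    rw [step i _ a hψ, ih hψ']
    ext x
    ring

variable {h : ℝ} {c : ι → EuclideanSpace ℝ (Fin d)}
  {ψ : EuclideanSpace ℝ (Fin d) → ℝ}

theorem norm_sub_le_of_superpose_ne_zero (hh : 0 < h)
    (hψ : tsupport ψ ⊆ Metric.closedBall 0 (1 / 3)) {x y : EuclideanSpace ℝ (Fin d)}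
    (hx : ψ (h⁻¹ • (x - y)) ≠ 0) : ‖x - y‖ ≤ h / 3 := by
  have := hψ (subset_tsupport _ hx)
  rw [mem_closedBall_zero_iff, norm_smul, norm_inv, Real.norm_of_nonneg hh.le,
    inv_mul_le_iff₀ hh] at this
  linarith

/-- Two bumps alive at `x` would have centres within `2h/3 < h` of each other. -/
theorem exists_finset_superpose (hh : 0 < h) (hc : Pairwise fun k l => h ≤ dist (c k) (c l))
    (hψ : tsupport ψ ⊆ Metric.closedBall 0 (1 / 3)) (x : EuclideanSpace ℝ (Fin d)) :
    ∃ S : Finset ι, S.card ≤ 1 ∧ ∀ k ∉ S, ψ (h⁻¹ • (x - c k)) = 0 := by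
  classical
  refine ⟨Finset.univ.filter fun k => ψ (h⁻¹ • (x - c k)) ≠ 0, ?_, by simp⟩
  rw [Finset.card_le_one]
  intro k hk l hl
  by_contra hkl
  have h1 := norm_sub_le_of_superpose_ne_zero hh hψ (Finset.mem_filter.1 hk).2
  have h2 := norm_sub_le_of_superpose_ne_zero hh hψ (Finset.mem_filter.1 hl).2
  have h3 := hc hkl
  have h4 := dist_triangle_left (c k) (c l) x
  rw [dist_eq_norm x, dist_eq_norm x] at h4
  linarith

theorem abs_superpose_le (hh : 0 < h) (hc : Pairwise fun k l => h ≤ dist (c k) (c l))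
    (hψ : tsupport ψ ⊆ Metric.closedBall 0 (1 / 3)) {η : ι → ℝ} (hη : ∀ k, |η k| ≤ 1)
    {B : ℝ} (hB : ∀ x, |ψ x| ≤ B) (x : EuclideanSpace ℝ (Fin d)) :
    |superpose h c η ψ x| ≤ B := by
  obtain ⟨S, hS, hS'⟩ := exists_finset_superpose hh hc hψ x
  have hB0 : 0 ≤ B := (abs_nonneg _).trans (hB 0)
  have : superpose h c η ψ x = ∑ k ∈ S, η k * ψ (h⁻¹ • (x - c k)) :=
    (Finset.sum_subset (Finset.subset_univ S) fun k _ hk => by rw [hS' k hk, mul_zero]).symm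
  rw [this]
  calc _ ≤ ∑ k ∈ S, |η k * ψ (h⁻¹ • (x - c k))| := Finset.abs_sum_le_sum_abs _ _
    _ ≤ ∑ k ∈ S, B := Finset.sum_le_sum fun k _ => by
        rw [abs_mul]
        exact (mul_le_of_le_one_left (abs_nonneg _) (hη k)).trans (hB _)
    _ ≤ 1 * B := by
        rw [Finset.sum_const, nsmul_eq_mul]
        gcongr
        exact_mod_cast hS
    _ = B := one_mul B

/-- Only the bump alive at `x` and the one alive at `y` contribute, whence the factor `2`, whatever
the number of bumps. -/
theorem abs_superpose_sub_le (hh : 0 < h) (hc : Pairwise fun k l => h ≤ dist (c k) (c l))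
    (hψ : tsupport ψ ⊆ Metric.closedBall 0 (1 / 3)) {η : ι → ℝ} (hη : ∀ k, |η k| ≤ 1)
    {B : ℝ} (hB0 : 0 ≤ B) (hB : ∀ x y, |ψ x - ψ y| ≤ B * ‖x - y‖)
    (x y : EuclideanSpace ℝ (Fin d)) :
    |superpose h c η ψ x - superpose h c η ψ y| ≤ 2 * (B * (‖x - y‖ / h)) := by
  classical
  obtain ⟨S, hS, hS'⟩ := exists_finset_superpose hh hc hψ x
  obtain ⟨T, hT, hT'⟩ := exists_finset_superpose hh hc hψ y
  have : superpose h c η ψ x - superpose h c η ψ y =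
      ∑ k ∈ S ∪ T, η k * (ψ (h⁻¹ • (x - c k)) - ψ (h⁻¹ • (y - c k))) := by
    unfold superpose
    rw [← Finset.sum_sub_distrib]
    simp only [← mul_sub]
    refine (Finset.sum_subset (Finset.subset_univ _) fun k _ hk => ?_).symm
    rw [Finset.mem_union, not_or] at hk
    rw [hS' k hk.1, hT' k hk.2, sub_zero, mul_zero]
  rw [this]
  calc _ ≤ ∑ k ∈ S ∪ T, |η k * (ψ (h⁻¹ • (x - c k)) - ψ (h⁻¹ • (y - c k)))| :=
        Finset.abs_sum_le_sum_abs _ _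
    _ ≤ ∑ k ∈ S ∪ T, B * (‖x - y‖ / h) := Finset.sum_le_sum fun k _ => by
        rw [abs_mul]
        refine (mul_le_of_le_one_left (abs_nonneg _) (hη k)).trans ((hB _ _).trans_eq ?_)
        rw [← smul_sub, sub_sub_sub_cancel_right, norm_smul, norm_inv, Real.norm_of_nonneg hh.le]
        ring
    _ ≤ 2 * (B * (‖x - y‖ / h)) := by
        rw [Finset.sum_const, nsmul_eq_mul]
        gcongr
        have := Finset.card_union_le S T
        exact_mod_cast this.trans (by omega)

theorem abs_superpose_eq (hh : 0 < h) (hc : Pairwise fun k l => h ≤ dist (c k) (c l))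
    (hψ : tsupport ψ ⊆ Metric.closedBall 0 (1 / 3)) (hψ0 : ∀ x, 0 ≤ ψ x) (η : ι → ℝ)
    (x : EuclideanSpace ℝ (Fin d)) :
    |superpose h c η ψ x| = superpose h c (fun k => |η k|) ψ x := by
  obtain ⟨S, hS, hS'⟩ := exists_finset_superpose hh hc hψ x
  have key : ∀ η : ι → ℝ, superpose h c η ψ x = ∑ k ∈ S, η k * ψ (h⁻¹ • (x - c k)) := fun η =>
    (Finset.sum_subset (Finset.subset_univ S) fun k _ hk => by rw [hS' k hk, mul_zero]).symm
  rw [key, key]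
  rcases Nat.le_one_iff_eq_zero_or_eq_one.1 hS with h0 | h1
  · simp [Finset.card_eq_zero.1 h0]
  · obtain ⟨k, rfl⟩ := Finset.card_eq_one.1 h1
    simp [abs_mul, abs_of_nonneg (hψ0 _)]

theorem integral_superpose (hh : 0 < h) (hψ : Integrable ψ) (η : ι → ℝ) :
    ∫ x, superpose h c η ψ x = (∑ k, η k) * (h ^ d * ∫ x, ψ x) := by
  have hi : ∀ k, Integrable fun x => η k * ψ (h⁻¹ • (x - c k)) := fun k =>
    ((hψ.comp_smul (inv_ne_zero hh.ne')).comp_sub_right (c k)).const_mul (η k)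
  unfold superpose
  rw [integral_finsetSum _ fun k _ => hi k, Finset.sum_mul]
  refine Finset.sum_congr rfl fun k _ => ?_
  rw [integral_const_mul, integral_sub_right_eq_self (fun x => ψ (h⁻¹ • x)) (c k),
    Measure.integral_comp_inv_smul_of_nonneg _ _ hh.le]
  simp

theorem superpose_sub (η θ : ι → ℝ) (x : EuclideanSpace ℝ (Fin d)) :
    superpose h c η ψ x - superpose h c θ ψ x = superpose h c (fun k => η k - θ k) ψ x := by
  simp only [superpose, ← Finset.sum_sub_distrib, sub_mul]

end Superposition

/-! ### The fractional seminorm of functions oscillating at scale `h` -/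

section Slobodeckij

variable {d : ℕ}

/-- In polar coordinates the integrand is `r^{q-1-σq}` on `(0, 1]`, integrable since `σ < 1`, and
`r^{-1-σq}` beyond `1`, integrable since `σ > 0`. -/
theorem integrable_min_one_norm_rpow_mul [Nontrivial (EuclideanSpace ℝ (Fin d))] {σ q : ℝ}
    (hσ : 0 < σ) (hσ1 : σ < 1) (hq : 1 ≤ q) :
    Integrable fun w : EuclideanSpace ℝ (Fin d) => min 1 ‖w‖ ^ q * ‖w‖ ^ (-(d + σ * q)) := by
  have hd : 1 ≤ d := by
    have := Module.finrank_pos (R := ℝ) (M := EuclideanSpace ℝ (Fin d))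
    rwa [finrank_euclideanSpace_fin] at this
  refine (integrable_fun_norm_addHaar (E := EuclideanSpace ℝ (Fin d)) volume
    (f := fun r : ℝ => min 1 r ^ q * r ^ (-(d + σ * q)))).2 ?_
  rw [finrank_euclideanSpace_fin, ← Ioc_union_Ioi_eq_Ioi (zero_le_one' ℝ)]
  have hpow : ∀ r : ℝ, 0 < r → r ^ (d - 1) = r ^ ((d : ℝ) - 1) := fun r hr => by
    rw [← Real.rpow_natCast]
    push_cast [Nat.cast_sub hd]
    rfl
  have hq0 : 0 < q := by linarith
  refine IntegrableOn.union ?_ ?_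
  · have h : IntegrableOn (fun r : ℝ => r ^ (q - 1 - σ * q)) (Ioc 0 1) :=
      (intervalIntegrable_iff_integrableOn_Ioc_of_le zero_le_one).1
        (intervalIntegral.intervalIntegrable_rpow' (by nlinarith))
    refine h.congr_fun (fun r hr => ?_) measurableSet_Ioc
    simp only [smul_eq_mul]
    rw [min_eq_right hr.2, hpow r hr.1, ← Real.rpow_add hr.1, ← Real.rpow_add hr.1]
    congr 1
    ring
  · have h : IntegrableOn (fun r : ℝ => r ^ (-1 - σ * q)) (Ioi 1) :=
      integrableOn_Ioi_rpow_of_lt (by nlinarith) one_pos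
    refine h.congr_fun (fun r hr => ?_) measurableSet_Ioi
    have hr0 : (0 : ℝ) < r := one_pos.trans hr
    simp only [smul_eq_mul]
    rw [min_eq_left (mem_Ioi.1 hr).le, hpow r hr0, Real.one_rpow, one_mul, ← Real.rpow_add hr0]
    congr 1
    ring

/-- The kernel `min(1, |v| / h)^q |v|^{-(d + σ q)}` has integral proportional to `h^{-σ q}`. -/
theorem lintegral_slobodeckij_kernel [Nontrivial (EuclideanSpace ℝ (Fin d))] {σ q : ℝ}
    (hσ : 0 < σ) (hσ1 : σ < 1) (hq : 1 ≤ q) {h : ℝ} (hh : 0 < h) :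
    ∫⁻ v : EuclideanSpace ℝ (Fin d),
        ENNReal.ofReal (min 1 (‖v‖ / h) ^ q * ‖v‖ ^ (-(d + σ * q))) =
      ENNReal.ofReal (h ^ (-(σ * q))) *
        ENNReal.ofReal (∫ w : EuclideanSpace ℝ (Fin d),
          min 1 ‖w‖ ^ q * ‖w‖ ^ (-(d + σ * q))) := by
  set κ : EuclideanSpace ℝ (Fin d) → ℝ := fun w => min 1 ‖w‖ ^ q * ‖w‖ ^ (-(d + σ * q))
  have hκ : Integrable κ := integrable_min_one_norm_rpow_mul hσ hσ1 hq
  have heq : (fun v : EuclideanSpace ℝ (Fin d) =>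
      min 1 (‖v‖ / h) ^ q * ‖v‖ ^ (-(d + σ * q))) =
        fun v => h ^ (-(d + σ * q)) * κ (h⁻¹ • v) := by
    ext v
    simp only [κ, norm_smul, norm_inv, Real.norm_of_nonneg hh.le]
    rw [Real.mul_rpow (inv_nonneg.2 hh.le) (norm_nonneg v), Real.inv_rpow hh.le,
      div_eq_inv_mul]
    have : h ^ (-(d + σ * q)) ≠ 0 := (Real.rpow_pos_of_pos hh _).ne'
    field_simp
  have hint : Integrable fun v => h ^ (-(d + σ * q)) * κ (h⁻¹ • v) :=
    (hκ.comp_smul (inv_ne_zero hh.ne')).const_mul _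
  have hκ0 : ∀ w, 0 ≤ κ w := fun w => by positivity
  rw [← ofReal_integral_eq_lintegral_ofReal (by rw [heq]; exact hint)
    (.of_forall fun v => by positivity), ← ENNReal.ofReal_mul (by positivity), heq,
    integral_const_mul, Measure.integral_comp_inv_smul_of_nonneg _ _ hh.le,
    finrank_euclideanSpace_fin, smul_eq_mul, ← mul_assoc, ← Real.rpow_natCast,
    ← Real.rpow_add hh]
  congr 3
  ring

theorem enorm_slobodeckij_quotient_rpow_le {σ q : ℝ} (hq : 1 ≤ q)
    {h : ℝ} {g : EuclideanSpace ℝ (Fin d) → ℝ} {B : ℝ} (hB : 0 ≤ B)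
    (hh : 0 < h) {x y : EuclideanSpace ℝ (Fin d)}
    (hg : |g x - g y| ≤ B * min 1 (‖x - y‖ / h)) :
    ‖(g x - g y) / ‖x - y‖ ^ ((d : ℝ) / q + σ)‖ₑ ^ q ≤
      ENNReal.ofReal (B ^ q) *
        ENNReal.ofReal (min 1 (‖x - y‖ / h) ^ q * ‖x - y‖ ^ (-(d + σ * q))) := by
  have hq0 : 0 < q := by linarith
  rw [Real.enorm_eq_ofReal_abs, ENNReal.ofReal_rpow_of_nonneg (abs_nonneg _) hq0.le,
    ← ENNReal.ofReal_mul (by positivity)]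
  refine ENNReal.ofReal_le_ofReal ?_
  rw [abs_div, abs_of_nonneg (Real.rpow_nonneg (norm_nonneg _) _),
    Real.div_rpow (abs_nonneg _) (by positivity), ← Real.rpow_mul (norm_nonneg _),
    show ((d : ℝ) / q + σ) * q = d + σ * q by field_simp, Real.rpow_neg (norm_nonneg _),
    ← mul_assoc, ← Real.mul_rpow hB (by positivity), div_eq_mul_inv]
  gcongr

/-- A function with oscillation at most `B min(1, |x - y| / h)` has Slobodeckij seminorm of
order `B h^{-σ}`. -/
theorem exists_slobodeckij_le {Ω : Set (EuclideanSpace ℝ (Fin d))} (hΩ : volume Ω ≠ ⊤) {σ : ℝ}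
    (hσ : 0 < σ) (hσ1 : σ < 1) {p : ℝ≥0∞} (hp : 1 ≤ p) :
    ∃ C : ℝ≥0∞, C ≠ ⊤ ∧ ∀ (h B : ℝ) (g : EuclideanSpace ℝ (Fin d) → ℝ), 0 < h → 0 ≤ B →
      (∀ x y, |g x - g y| ≤ B * min 1 (‖x - y‖ / h)) →
        slobodeckij Ω σ p g ≤ C * ENNReal.ofReal (B * h ^ (-σ)) := by
  -- Polar coordinates need `d > 0`; for `d = 0` every difference vanishes.
  rcases subsingleton_or_nontrivial (EuclideanSpace ℝ (Fin d)) with hE | hE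
  · refine ⟨0, by simp, fun h B g _ _ _ => ?_⟩
    have : (fun z : EuclideanSpace ℝ (Fin d) × EuclideanSpace ℝ (Fin d) =>
        (g z.1 - g z.2) / ‖z.1 - z.2‖ ^ (((d : ℝ≥0∞) / p).toReal + σ)) = 0 := by
      ext z
      simp [Subsingleton.elim z.1 z.2]
    rw [slobodeckij, this, eLpNorm_zero]
    exact zero_le
  rcases eq_or_ne p ⊤ with rfl | hp'
  · refine ⟨1, by simp, fun h B g hh hB hg => ?_⟩
    refine (eLpNorm_le_of_ae_bound (C := B * h ^ (-σ)) (.of_forall fun z => ?_)).trans ?_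
    · have h1 := hg z.1 z.2
      have h2 : ((d : ℝ≥0∞) / ⊤).toReal + σ = σ := by simp
      rw [h2, Real.norm_eq_abs, abs_div, abs_of_nonneg (Real.rpow_nonneg (norm_nonneg _) _)]
      refine div_le_of_le_mul₀ (by positivity) (by positivity) (h1.trans ?_)
      rw [mul_assoc]
      gcongr
      set t := ‖z.1 - z.2‖ / h with ht
      have ht0 : 0 ≤ t := by positivity
      have : h ^ (-σ) * ‖z.1 - z.2‖ ^ σ = t ^ σ := by
        rw [ht, Real.div_rpow (norm_nonneg _) hh.le, Real.rpow_neg hh.le]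
        ring
      rw [this]
      rcases le_total t 1 with h3 | h3
      · exact (min_le_right _ _).trans
          (by simpa using Real.rpow_le_rpow_of_exponent_ge' ht0 h3 hσ.le hσ1.le)
      · exact (min_le_left _ _).trans (Real.one_le_rpow h3 hσ.le)
    · simp
  · have hp0 : p ≠ 0 := (zero_lt_one.trans_le hp).ne'
    set q := p.toReal with hqdef
    have hq : 1 ≤ q := by
      have := (ENNReal.toReal_le_toReal ENNReal.one_ne_top hp').2 hp
      simpa using this
    have hq0 : 0 < q := by linarith
    set J := ENNReal.ofReal (∫ w : EuclideanSpace ℝ (Fin d),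
          min 1 ‖w‖ ^ q * ‖w‖ ^ (-(d + σ * q)))
    refine ⟨(volume Ω * J) ^ (1 / q), ?_, fun h B g hh hB hg => ?_⟩
    · exact ENNReal.rpow_ne_top_of_nonneg (by positivity)
        (ENNReal.mul_ne_top hΩ ENNReal.ofReal_ne_top)
    rw [slobodeckij, eLpNorm_eq_lintegral_rpow_enorm_toReal hp0 hp', ← hqdef]
    have hdp : ((d : ℝ≥0∞) / p).toReal = d / q := by simp [ENNReal.toReal_div, hqdef]
    rw [hdp]
    have hk : Measurable fun v : EuclideanSpace ℝ (Fin d) =>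
        ENNReal.ofReal (min 1 (‖v‖ / h) ^ q * ‖v‖ ^ (-(d + σ * q))) := by fun_prop
    have hle : ∫⁻ z, ‖(g z.1 - g z.2) / ‖z.1 - z.2‖ ^ ((d : ℝ) / q + σ)‖ₑ ^ q
          ∂((volume.restrict Ω).prod (volume.restrict Ω)) ≤
        ENNReal.ofReal (B * h ^ (-σ)) ^ q * (volume Ω * J) := by
      calc _ ≤ ∫⁻ z : EuclideanSpace ℝ (Fin d) × EuclideanSpace ℝ (Fin d),
            ENNReal.ofReal (B ^ q) * ENNReal.ofReal
              (min 1 (‖z.1 - z.2‖ / h) ^ q * ‖z.1 - z.2‖ ^ (-(d + σ * q)))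
            ∂((volume.restrict Ω).prod (volume.restrict Ω)) :=
            lintegral_mono fun z => enorm_slobodeckij_quotient_rpow_le hq hB hh (hg z.1 z.2)
        _ = ENNReal.ofReal (B ^ q) * ∫⁻ x in Ω, ∫⁻ y in Ω, ENNReal.ofReal
              (min 1 (‖x - y‖ / h) ^ q * ‖x - y‖ ^ (-(d + σ * q))) := by
            have hk' : Measurable fun z : EuclideanSpace ℝ (Fin d) × EuclideanSpace ℝ (Fin d) =>
                ENNReal.ofReal (min 1 (‖z.1 - z.2‖ / h) ^ q * ‖z.1 - z.2‖ ^ (-(d + σ * q))) :=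
              hk.comp (measurable_fst.sub measurable_snd)
            rw [lintegral_const_mul' _ _ ENNReal.ofReal_ne_top, lintegral_prod _ hk'.aemeasurable]
        _ ≤ ENNReal.ofReal (B ^ q) * ∫⁻ _ in Ω, ENNReal.ofReal (h ^ (-(σ * q))) * J := by
            gcongr with x
            -- The inner integral is enlarged to the whole space, where it no longer depends on `x`;
            -- only the volume of `Ω` enters, not its boundary.
            refine (setLIntegral_le_lintegral _ _).trans (le_of_eq ?_)
            rw [← lintegral_slobodeckij_kernel hσ hσ1 hq hh]
            exact lintegral_sub_left_eq_self (fun v : EuclideanSpace ℝ (Fin d) =>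
              ENNReal.ofReal (min 1 (‖v‖ / h) ^ q * ‖v‖ ^ (-(d + σ * q)))) x
        _ = _ := by
            rw [setLIntegral_const, ENNReal.ofReal_rpow_of_nonneg (by positivity) hq0.le,
              Real.mul_rpow hB (by positivity), ← Real.rpow_mul hh.le, neg_mul,
              ENNReal.ofReal_mul (by positivity)]
            ring
    refine (ENNReal.rpow_le_rpow hle (by positivity)).trans (le_of_eq ?_)
    rw [ENNReal.mul_rpow_of_nonneg _ _ (by positivity), ← ENNReal.rpow_mul,
      mul_one_div_cancel hq0.ne', ENNReal.rpow_one, mul_comm]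

end Slobodeckij

/-! ### Sobolev norm of a sum of bumps -/

section SobolevBound

variable {d : ℕ}

theorem mem_multiIdx {k : ℕ} {α : Fin d → ℕ} : α ∈ multiIdx d k ↔ ∑ i, α i = k := by
  simp [multiIdx]

/-- For finite `p`, each term of the sum is at most `β^p ≤ β`, as `β ≤ 1 ≤ p`, so the number of
terms times `β` bounds the sum. This avoids `p`-th roots in the choice of the amplitude. -/
theorem sobolevNormOf_le_one {Ω : Set (EuclideanSpace ℝ (Fin d))} {s : ℝ} {p : ℝ≥0∞}
    (hp : 1 ≤ p) {g : (Fin d → ℕ) → EuclideanSpace ℝ (Fin d) → ℝ} {β : ℝ≥0∞} (hβ : β ≤ 1)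
    (hβ' : ((∑ k ∈ Finset.range (⌊s⌋₊ + 1), (multiIdx d k).card + (multiIdx d ⌊s⌋₊).card : ℕ) :
      ℝ≥0∞) * β ≤ 1)
    (hg : ∀ α, ∑ i, α i ≤ ⌊s⌋₊ → eLpNorm (g α) p (volume.restrict Ω) ≤ β)
    (hg' : s - ⌊s⌋₊ ≠ 0 → ∀ α, ∑ i, α i = ⌊s⌋₊ → slobodeckij Ω (s - ⌊s⌋₊) p (g α) ≤ β) :
    sobolevNormOf Ω s p g ≤ 1 := by
  have hsemi : ∀ α ∈ multiIdx d ⌊s⌋₊,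
      (if s - ⌊s⌋₊ = 0 then 0 else slobodeckij Ω (s - ⌊s⌋₊) p (g α)) ≤ β := by
    intro α hα
    split_ifs with h
    · exact zero_le
    · exact hg' h α (mem_multiIdx.1 hα)
  have hlp : ∀ k ∈ Finset.range (⌊s⌋₊ + 1), ∀ α ∈ multiIdx d k,
      eLpNorm (g α) p (volume.restrict Ω) ≤ β := by
    intro k hk α hα
    refine hg α ?_
    rw [mem_multiIdx.1 hα]
    exact Nat.lt_succ_iff.1 (Finset.mem_range.1 hk)
  unfold sobolevNormOf
  simp only
  by_cases hp' : p = ⊤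
  · rw [if_pos hp']
    exact (max_le (iSup₂_le fun k hk => iSup₂_le fun α hα => hlp k hk α hα)
      (iSup₂_le hsemi)).trans hβ
  · rw [if_neg hp']
    have hq : 1 ≤ p.toReal := by
      have := (ENNReal.toReal_le_toReal ENNReal.one_ne_top hp').2 hp
      simpa using this
    have hpow : ∀ {x : ℝ≥0∞}, x ≤ β → x ^ p.toReal ≤ β := fun {x} hx =>
      (ENNReal.rpow_le_rpow_of_exponent_ge (hx.trans hβ) hq).trans (by simpa using hx)
    refine ENNReal.rpow_le_one ?_ (one_div_nonneg.2 (by linarith))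
    refine le_trans (add_le_add
      (Finset.sum_le_sum fun k hk => Finset.sum_le_sum fun α hα => hpow (hlp k hk α hα))
      (Finset.sum_le_sum fun α hα => hpow (hsemi α hα))) (le_trans (le_of_eq ?_) hβ')
    simp only [Finset.sum_const, nsmul_eq_mul]
    push_cast
    rw [add_mul, Finset.sum_mul]

theorem exists_bound_revMultiD {K : Set (EuclideanSpace ℝ (Fin d))} (hK : IsCompact K)
    {φ : EuclideanSpace ℝ (Fin d) → ℝ} (hφ : SmoothSupportedIn K φ) (m : ℕ) :
    ∃ B : ℝ, 0 ≤ B ∧ ∀ α : Fin d → ℕ, ∑ i, α i ≤ m → (∀ x, |revMultiD α φ x| ≤ B) ∧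
      ∀ x y, |revMultiD α φ x - revMultiD α φ y| ≤ B * ‖x - y‖ := by
  have h1 : ∀ α : Fin d → ℕ, ∃ B : ℝ, 0 ≤ B ∧ (∀ x, |revMultiD α φ x| ≤ B) ∧
      ∀ x y, |revMultiD α φ x - revMultiD α φ y| ≤ B * ‖x - y‖ := by
    intro α
    have hs : SmoothSupportedIn K (revMultiD α φ) :=
      revMultiD_induction (P := SmoothSupportedIn K) (fun _ i h => h.partialD i) α hφ
    have hc := hs.hasCompactSupport hK
    obtain ⟨B, hB⟩ := hc.exists_bound_of_continuous hs.1.continuous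
    obtain ⟨C, hC⟩ := hs.1.lipschitzWith_of_hasCompactSupport hc (by simp)
    refine ⟨max B C, le_max_of_le_right C.coe_nonneg,
      fun x => (hB x).trans (le_max_left _ _), fun x y => ?_⟩
    have := hC.dist_le_mul x y
    rw [Real.dist_eq, dist_eq_norm] at this
    exact this.trans (by gcongr; exact le_max_right _ _)
  choose B hB0 hB hB' using h1
  let F := (Finset.range (m + 1)).biUnion (multiIdx d)
  refine ⟨∑ α ∈ F, B α, Finset.sum_nonneg fun α _ => hB0 α, fun α hα => ?_⟩
  have hαF : α ∈ F := Finset.mem_biUnion.2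
    ⟨_, Finset.mem_range.2 (Nat.lt_succ_iff.2 hα), mem_multiIdx.2 rfl⟩
  have hle : B α ≤ ∑ α ∈ F, B α := Finset.single_le_sum (fun α _ => hB0 α) hαF
  exact ⟨fun x => (hB α x).trans hle, fun x y => (hB' α x y).trans (by gcongr)⟩

theorem exists_pos_mul_ofReal_le_one {V : ℝ≥0∞} (hV : V ≠ ⊤) (T : ℕ) {B : ℝ} (hB : 0 ≤ B) :
    ∃ a : ℝ, 0 < a ∧ V * ENNReal.ofReal (a * (2 * B)) ≤ 1 ∧
      T * (V * ENNReal.ofReal (a * (2 * B))) ≤ 1 := by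
  have hVr : 0 ≤ V.toReal := ENNReal.toReal_nonneg
  have hT : (0 : ℝ) ≤ T := Nat.cast_nonneg T
  have h2B : 0 ≤ 2 * B := by linarith
  refine ⟨1 / ((T + 1) * (V.toReal + 1) * (2 * B + 1)), by positivity, ?_⟩
  set a : ℝ := 1 / ((T + 1) * (V.toReal + 1) * (2 * B + 1)) with ha
  have ha0 : 0 < a := by positivity
  have key : (T + 1) * (V.toReal * (a * (2 * B))) ≤ 1 := by
    calc (T + 1) * (V.toReal * (a * (2 * B)))
        ≤ (T + 1) * ((V.toReal + 1) * (a * (2 * B + 1))) := by gcongr <;> linarith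
      _ = 1 := by rw [ha]; field_simp
  have h0 : 0 ≤ V.toReal * (a * (2 * B)) := by positivity
  rw [← ENNReal.ofReal_toReal hV, ← ENNReal.ofReal_mul hVr, ← ENNReal.ofReal_natCast,
    ← ENNReal.ofReal_mul hT, ENNReal.ofReal_le_one, ENNReal.ofReal_le_one]
  constructor <;> nlinarith

/-- Superpositions of separated bumps of width `h` and height of order `h^s` lie in the unit ball
of `W^{s,p}`. -/
theorem exists_sobolevNorm_superpose_le_one {Ω : Set (EuclideanSpace ℝ (Fin d))}
    (hΩ : volume Ω ≠ ⊤) {s : ℝ} (hs : 0 < s) {p : ℝ≥0∞} (hp : 1 ≤ p)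
    {φ : EuclideanSpace ℝ (Fin d) → ℝ}
    (hφ : SmoothSupportedIn (Metric.closedBall 0 (1 / 3)) φ) :
    ∃ a : ℝ, 0 < a ∧ ∀ {ι : Type} [Fintype ι] (h : ℝ) (c : ι → EuclideanSpace ℝ (Fin d))
      (η : ι → ℝ), 0 < h → h ≤ 1 → (Pairwise fun k l => h ≤ dist (c k) (c l)) →
      (∀ k, |η k| ≤ 1) → ∀ v : EuclideanSpace ℝ (Fin d) → ℝ, LocallyIntegrableOn v Ω →
      v =ᵐ[volume.restrict Ω] (fun x => a * h ^ s * superpose h c η φ x) →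
      sobolevNorm Ω s p v ≤ 1 := by
  set m := ⌊s⌋₊ with hm
  have hms : (m : ℝ) ≤ s := Nat.floor_le hs.le
  have hsm : s < m + 1 := Nat.lt_floor_add_one s
  have hK : IsCompact (Metric.closedBall (0 : EuclideanSpace ℝ (Fin d)) (1 / 3)) :=
    isCompact_closedBall _ _
  obtain ⟨B, hB0, hB⟩ := exists_bound_revMultiD hK hφ m
  obtain ⟨C, hC, hslob⟩ : ∃ C : ℝ≥0∞, C ≠ ⊤ ∧ (s - m ≠ 0 →
      ∀ (h B : ℝ) (g : EuclideanSpace ℝ (Fin d) → ℝ), 0 < h → 0 ≤ B →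
      (∀ x y, |g x - g y| ≤ B * min 1 (‖x - y‖ / h)) →
        slobodeckij Ω (s - m) p g ≤ C * ENNReal.ofReal (B * h ^ (-(s - m)))) := by
    by_cases h0 : s - m = 0
    · exact ⟨0, by simp, fun h => absurd h0 h⟩
    · obtain ⟨C, hC, hC'⟩ := exists_slobodeckij_le hΩ
        (lt_of_le_of_ne (sub_nonneg.2 hms) (Ne.symm h0)) (by linarith) hp
      exact ⟨C, hC, fun _ => hC'⟩
  -- One constant for both the `Lᵖ`-norms and the seminorms. For `p = ∞` the exponent `p.toReal⁻¹`
  -- is `0`, which is the correct value.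
  set V : ℝ≥0∞ := volume Ω ^ p.toReal⁻¹ + C with hV
  have hVtop : V ≠ ⊤ := ENNReal.add_ne_top.2
    ⟨ENNReal.rpow_ne_top_of_nonneg (by positivity) hΩ, hC⟩
  set T : ℕ := ∑ k ∈ Finset.range (m + 1), (multiIdx d k).card + (multiIdx d m).card
  obtain ⟨a, ha0, hβ1, hβT⟩ := exists_pos_mul_ofReal_le_one hVtop T hB0
  set β : ℝ≥0∞ := V * ENNReal.ofReal (a * (2 * B)) with hβdef
  refine ⟨a, ha0, fun {ι} _ h c η hh hh1 hc hη v hv hvu => ?_⟩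
  have hφ1 := hφ.1
  have hder : ∀ α, revMultiD α (fun x => a * h ^ s * superpose h c η φ x) =
      fun x => a * h ^ s * h⁻¹ ^ (∑ i, α i) * superpose h c η (revMultiD α φ) x :=
    fun α => revMultiD_const_mul_superpose hφ1 h c η _ α
  have hsupp : ∀ α, tsupport (revMultiD α φ) ⊆ Metric.closedBall 0 (1 / 3) := fun α =>
    (revMultiD_induction (P := SmoothSupportedIn (Metric.closedBall 0 (1 / 3)))
      (fun _ i h => h.partialD i) α hφ).2
  have hsmooth : ContDiff ℝ ∞ fun x => a * h ^ s * superpose h c η φ x :=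
    contDiff_const.mul (hφ1.superpose h c η)
  -- Each derivative costs a factor `h⁻¹`; for `k ≤ m ≤ s` and `h ≤ 1` the remaining power of `h` is
  -- at most `1`.
  have hscale : ∀ k : ℕ, h ^ s * h⁻¹ ^ k = h ^ (s - k) := fun k => by
    rw [Real.rpow_sub hh, Real.rpow_natCast, inv_pow, div_eq_mul_inv]
  refine (iInf₂_le (fun α => revMultiD α (fun x => a * h ^ s * superpose h c η φ x))
    fun α _ => isWeakDeriv_revMultiD hsmooth hvu hv α).trans ?_
  refine sobolevNormOf_le_one (β := β) hp hβ1 hβT ?_ ?_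
  · intro α hα
    rw [hder]
    have hb : ∀ x, ‖a * h ^ s * h⁻¹ ^ (∑ i, α i) * superpose h c η (revMultiD α φ) x‖ ≤
        a * (2 * B) := by
      intro x
      have h1 := abs_superpose_le hh hc (hsupp α) hη (hB α hα).1 x
      have h2 : h ^ (s - (∑ i, α i : ℕ)) ≤ 1 := by
        refine Real.rpow_le_one hh.le hh1 (sub_nonneg.2 (le_trans ?_ hms))
        exact_mod_cast hα
      rw [mul_assoc a, hscale, Real.norm_eq_abs, abs_mul, abs_of_nonneg (by positivity), mul_assoc]
      refine mul_le_mul_of_nonneg_left ?_ ha0.le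
      calc _ ≤ 1 * B := mul_le_mul h2 h1 (abs_nonneg _) zero_le_one
        _ ≤ 2 * B := by linarith
    refine (eLpNorm_le_of_ae_bound (.of_forall hb)).trans ?_
    rw [Measure.restrict_apply_univ, hβdef]
    gcongr
    exact le_self_add
  · intro h0 α hα
    rw [hder, hα]
    have hbd := hB α hα.le
    have hosc : ∀ x y, |a * h ^ s * h⁻¹ ^ m * superpose h c η (revMultiD α φ) x -
        a * h ^ s * h⁻¹ ^ m * superpose h c η (revMultiD α φ) y| ≤
          a * h ^ s * h⁻¹ ^ m * (2 * B) * min 1 (‖x - y‖ / h) := by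
      intro x y
      rw [← mul_sub, abs_mul, abs_of_nonneg (by positivity), mul_assoc _ (2 * B)]
      gcongr
      rw [mul_min_of_nonneg _ _ (by positivity)]
      refine le_min ?_ ?_
      · have h1 := abs_superpose_le hh hc (hsupp α) hη hbd.1 x
        have h2 := abs_superpose_le hh hc (hsupp α) hη hbd.1 y
        rw [abs_le] at *
        constructor <;> linarith [h1.1, h1.2, h2.1, h2.2]
      · rw [mul_assoc]
        exact abs_superpose_sub_le hh hc (hsupp α) hη hB0 hbd.2 x y
    refine (hslob h0 h _ _ hh (by positivity) hosc).trans ?_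
    -- The seminorm costs exactly the remaining `h^{-(s-m)}`: the height `h^s` is critical.
    have : a * h ^ s * h⁻¹ ^ m * (2 * B) * h ^ (-(s - m)) = a * (2 * B) := by
      rw [mul_assoc a, hscale, Real.rpow_neg hh.le]
      have : h ^ (s - m) ≠ 0 := (Real.rpow_pos_of_pos hh _).ne'
      field_simp
    rw [this, hβdef]
    gcongr
    exact le_add_self

end SobolevBound

/-! ### Packing the Sobolev ball -/

section Packing

variable {d : ℕ}

/-- The points `x₀ + h k`, `k ∈ {0, …, M - 1}^d`. -/
noncomputable def cubeGrid (x₀ : EuclideanSpace ℝ (Fin d)) (h : ℝ) (M : ℕ) (k : Fin d → Fin M) :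
    EuclideanSpace ℝ (Fin d) :=
  x₀ + h • WithLp.toLp 2 fun i => ((k i : ℕ) : ℝ)

theorem cubeGrid_separated (x₀ : EuclideanSpace ℝ (Fin d)) {h : ℝ} (hh : 0 < h) (M : ℕ) :
    Pairwise fun k l => h ≤ dist (cubeGrid x₀ h M k) (cubeGrid x₀ h M l) := by
  intro k l hkl
  obtain ⟨i, hi⟩ := Function.ne_iff.1 hkl
  rw [cubeGrid, cubeGrid, dist_add_left, dist_eq_norm, ← smul_sub, norm_smul,
    Real.norm_of_nonneg hh.le]
  refine le_mul_of_one_le_right hh.le (le_trans ?_ (PiLp.norm_apply_le _ i))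
  have hi' : ((k i : ℕ) : ℤ) - (l i : ℕ) ≠ 0 := by
    intro h
    exact hi (Fin.ext (by omega))
  have := Int.one_le_abs hi'
  simp only [PiLp.sub_apply, Real.norm_eq_abs]
  exact_mod_cast this

theorem norm_cubeGrid_sub_le (x₀ : EuclideanSpace ℝ (Fin d)) {h : ℝ} (hh : 0 < h) (M : ℕ)
    (k : Fin d → Fin M) : ‖cubeGrid x₀ h M k - x₀‖ ≤ h * (√d * M) := by
  rw [cubeGrid, add_sub_cancel_left, norm_smul, Real.norm_of_nonneg hh.le]
  gcongr
  rw [EuclideanSpace.norm_eq]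
  refine Real.sqrt_le_iff.2 ⟨by positivity, ?_⟩
  rw [mul_pow, Real.sq_sqrt (by positivity)]
  calc _ ≤ ∑ _i : Fin d, (M : ℝ) ^ 2 := Finset.sum_le_sum fun i _ => by
        have : ((k i : ℕ) : ℝ) ≤ M := by exact_mod_cast (k i).2.le
        simp only [Real.norm_eq_abs, Nat.abs_cast]
        gcongr
    _ = _ := by simp

theorem sum_abs_indicator_sub {ι : Type*} [Fintype ι] [DecidableEq ι] (A B : Finset ι) :
    ∑ k, |(if k ∈ A then (1 : ℝ) else 0) - if k ∈ B then 1 else 0| = (symmDiff A B).card := by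
  have : ∀ k, |(if k ∈ A then (1 : ℝ) else 0) - if k ∈ B then 1 else 0| =
      if k ∈ symmDiff A B then 1 else 0 := fun k => by
    by_cases hA : k ∈ A <;> by_cases hB : k ∈ B <;> simp [Finset.mem_symmDiff, hA, hB]
  simp [this]

/-- Hölder's inequality on a finite measure space. It reduces separation in every `Lᵖ` to `L¹`,
where the distance of two sums of bumps is computed exactly. For `p = ∞` the exponent reads `1 - 1/0
= 1`, as it should. -/
theorem integral_le_dist_toLp_mul {α : Type*} [MeasurableSpace α] {μ : Measure α}
    [IsFiniteMeasure μ] {p : ℝ≥0∞} [Fact (1 ≤ p)] {f g : α → ℝ} (hf : MemLp f p μ)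
    (hg : MemLp g p μ) :
    ∫ x, |f x - g x| ∂μ ≤
      dist (hf.toLp f) (hg.toLp g) * (μ univ ^ (1 - 1 / p.toReal)).toReal := by
  have hp : 1 ≤ p := Fact.out
  have hfg := hf.sub hg
  have h1 := eLpNorm_le_eLpNorm_mul_rpow_measure_univ hp hfg.aestronglyMeasurable
  have h2 : ∫ x, |f x - g x| ∂μ = (eLpNorm (f - g) 1 μ).toReal := by
    rw [eLpNorm_one_eq_lintegral_enorm,
      ← integral_norm_eq_lintegral_enorm hfg.aestronglyMeasurable]
    rfl
  have h3 : 0 ≤ 1 - 1 / p.toReal := by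
    rcases eq_or_ne p ⊤ with rfl | hp'
    · simp
    · have : 1 ≤ p.toReal := by
        simpa using (ENNReal.toReal_le_toReal ENNReal.one_ne_top hp').2 hp
      have := (div_le_one (by linarith)).2 this
      linarith
  rw [h2, dist_edist, Lp.edist_toLp_toLp, ← ENNReal.toReal_mul]
  refine ENNReal.toReal_mono (ENNReal.mul_ne_top hfg.eLpNorm_ne_top
    (ENNReal.rpow_ne_top_of_nonneg h3 (measure_ne_top μ _))) ?_
  simpa using h1

/-- A lower bound for the packing numbers of the unit ball of `W^{s,p}` in `Lᵖ`. -/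
theorem exists_separated_sobolevUnitBall {D : Set (EuclideanSpace ℝ (Fin d))} (hD : IsCompact D)
    (hD' : (interior D).Nonempty) {s : ℝ} (hs : 0 < s) (p : ℝ≥0∞) [hp : Fact (1 ≤ p)] :
    ∃ κ ρ r : ℝ, 0 < κ ∧ 0 < ρ ∧ 1 < r ∧ ∀ M : ℕ, 0 < M →
      ∃ S : Finset (sobolevUnitBall D s p), r ^ (M ^ d) ≤ S.card ∧
        ∀ u ∈ S, ∀ v ∈ S, u ≠ v → κ * (ρ / M) ^ s ≤ dist u v := by
  classical
  set Ω := interior D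
  have hΩ : volume Ω ≠ ⊤ := (measure_mono interior_subset).trans_lt hD.measure_lt_top |>.ne
  have : IsFiniteMeasure (volume.restrict Ω) := ⟨by simpa using hΩ.lt_top⟩
  obtain ⟨x₀, hx₀⟩ := hD'
  obtain ⟨R, hR, hball⟩ := Metric.nhds_basis_closedBall.mem_iff.1 (isOpen_interior.mem_nhds hx₀)
  let φ : ContDiffBump (0 : EuclideanSpace ℝ (Fin d)) := ⟨1 / 4, 1 / 3, by norm_num, by norm_num⟩
  have hφ : SmoothSupportedIn (Metric.closedBall 0 (1 / 3)) φ :=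
    ⟨φ.contDiff, φ.tsupport_eq.subset⟩
  have hI : 0 < ∫ x, φ x := φ.integral_pos
  set I := ∫ x, φ x
  obtain ⟨a, ha, hnorm⟩ := exists_sobolevNorm_superpose_le_one hΩ hs hp.out hφ
  -- The grid reaches at most `ρ√d` from `x₀` and a bump adds `h/3 ≤ ρ`, so all supports lie in the
  -- ball of radius `R`; the minimum with `1` ensures `h ≤ 1`.
  set ρ : ℝ := min 1 (R / (√d + 1)) with hρdef
  have hρ : 0 < ρ := by positivity
  have hρR : ρ * (√d + 1) ≤ R :=
    (le_div_iff₀ (by positivity)).1 (min_le_right _ _)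
  set W : ℝ := ((volume.restrict Ω) univ ^ (1 - 1 / p.toReal)).toReal
  have hW : 0 ≤ W := ENNReal.toReal_nonneg
  -- At least `M^d/8` differing bumps, each of mass `a h^s h^d I` with `h M = ρ`, give `L¹`-distance
  -- at least `a ρ^d I h^s / 8`; Hölder divides by `W`, and `W + 1` avoids a zero denominator.
  refine ⟨a * ρ ^ d * I / (8 * (W + 1)), ρ, _, by positivity, hρ, one_lt_code_rate,
    fun M hM => ?_⟩
  have hM' : (1 : ℝ) ≤ M := by exact_mod_cast hM
  set h : ℝ := ρ / M with hhdef
  have hh : 0 < h := by positivity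
  have hhρ : h ≤ ρ := div_le_self hρ.le hM'
  have hhM : h * M = ρ := by rw [hhdef]; field_simp
  let c := cubeGrid x₀ h M
  have hc : Pairwise fun k l => h ≤ dist (c k) (c l) := cubeGrid_separated x₀ hh M
  let f : Finset (Fin d → Fin M) → EuclideanSpace ℝ (Fin d) → ℝ := fun A x =>
    a * h ^ s * superpose h c (fun k => if k ∈ A then 1 else 0) φ x
  have hη : ∀ (A : Finset (Fin d → Fin M)) k, |(if k ∈ A then (1 : ℝ) else 0)| ≤ 1 := by
    intro A k
    split_ifs <;> simp
  have hf : ∀ A, MemLp (f A) p (volume.restrict Ω) := fun A => by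
    refine MemLp.of_bound (C := a * h ^ s * 1) ?_ (.of_forall fun x => ?_)
    · exact (continuous_const.mul
        (hφ.1.superpose h c _).continuous).aestronglyMeasurable
    · rw [Real.norm_eq_abs, abs_mul, abs_of_nonneg (by positivity)]
      gcongr
      exact abs_superpose_le hh hc hφ.2 (hη A)
        (fun x => by rw [abs_of_nonneg φ.nonneg]; exact φ.le_one) x
  have hmem : ∀ A, (hf A).toLp (f A) ∈ sobolevUnitBall D s p := fun A => by
    refine hnorm h c _ hh (hhρ.trans (min_le_left _ _)) hc (hη A) _ ?_ (hf A).coeFn_toLp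
    have h1 : IntegrableOn ((hf A).toLp (f A)) Ω :=
      (Lp.memLp _).integrable hp.out
    exact h1.locallyIntegrableOn
  let u : Finset (Fin d → Fin M) → sobolevUnitBall D s p := fun A => ⟨_, hmem A⟩
  have hdist : ∀ A B : Finset (Fin d → Fin M), M ^ d ≤ 8 * (symmDiff A B).card →
      a * ρ ^ d * I / (8 * (W + 1)) * h ^ s ≤ dist (u A) (u B) := by
    intro A B hAB
    set η : (Fin d → Fin M) → ℝ := fun k =>
      |(if k ∈ A then (1 : ℝ) else 0) - if k ∈ B then 1 else 0| with hηdef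
    have h1 : ∀ x, |f A x - f B x| = a * h ^ s * superpose h c η φ x := fun x => by
      rw [← mul_sub, superpose_sub, abs_mul, abs_of_nonneg (by positivity),
        abs_superpose_eq hh hc hφ.2 (fun x => φ.nonneg)]
    have h2 : ∫ x in Ω, |f A x - f B x| = a * h ^ s * ((symmDiff A B).card * (h ^ d * I)) := by
      simp only [h1]
      rw [setIntegral_eq_integral_of_forall_compl_eq_zero, integral_const_mul,
        integral_superpose hh φ.integrable, hηdef, sum_abs_indicator_sub]
      intro x hx
      rw [superpose, Finset.sum_eq_zero, mul_zero]
      intro k _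
      by_contra hne
      have h3 := norm_sub_le_of_superpose_ne_zero hh hφ.2 (right_ne_zero_of_mul hne)
      refine hx (hball (mem_closedBall_iff_norm.2 ?_))
      have h4 := norm_cubeGrid_sub_le x₀ hh M k
      have h5 : h * (√d * M) = ρ * √d := by rw [← hhM]; ring
      calc ‖x - x₀‖ ≤ ‖x - c k‖ + ‖c k - x₀‖ := norm_sub_le_norm_sub_add_norm_sub _ _ _
        _ ≤ h / 3 + ρ * √d := add_le_add h3 (h4.trans_eq h5)
        _ ≤ ρ * (√d + 1) := by linarith
        _ ≤ R := hρR
    have h3 := integral_le_dist_toLp_mul (hf A) (hf B)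
    rw [h2] at h3
    have h4 : ρ ^ d ≤ 8 * ((symmDiff A B).card * h ^ d) := by
      calc ρ ^ d = (M ^ d : ℕ) * h ^ d := by rw [← hhM, mul_pow]; push_cast; ring
        _ ≤ (8 * (symmDiff A B).card : ℕ) * h ^ d := by gcongr
        _ = _ := by push_cast; ring
    have h5 : dist (u A) (u B) = dist ((hf A).toLp (f A)) ((hf B).toLp (f B)) := rfl
    rw [h5, div_mul_eq_mul_div, div_le_iff₀ (by positivity)]
    calc a * ρ ^ d * I * h ^ s ≤ a * (8 * ((symmDiff A B).card * h ^ d)) * I * h ^ s := by gcongr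
      _ = 8 * (a * h ^ s * ((symmDiff A B).card * (h ^ d * I))) := by ring
      _ ≤ 8 * (dist ((hf A).toLp (f A)) ((hf B).toLp (f B)) * W) := by gcongr
      _ ≤ 8 * (dist ((hf A).toLp (f A)) ((hf B).toLp (f B)) * (W + 1)) := by
          gcongr
          linarith
      _ = _ := by ring
  obtain ⟨S, hS, hcard⟩ := exists_separated_code (Fin d → Fin M)
  have hn : Fintype.card (Fin d → Fin M) = M ^ d := by simp
  rw [hn] at hS hcard
  have hpos : 0 < a * ρ ^ d * I / (8 * (W + 1)) * h ^ s := by positivity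
  have hinj : Set.InjOn u S := by
    intro A hA B hB hAB
    by_contra hne
    have := hdist A B (hS A hA B hB hne)
    rw [hAB, dist_self] at this
    linarith
  refine ⟨S.image u, by rwa [Finset.card_image_of_injOn hinj], ?_⟩
  intro v hv w hw hvw
  obtain ⟨A, hA, rfl⟩ := Finset.mem_image.1 hv
  obtain ⟨B, hB, rfl⟩ := Finset.mem_image.1 hw
  exact hdist A B (hS A hA B hB fun h => hvw (by rw [h]))

end Packing

/-! ### Matching the bump scale to `ε` -/

theorem mainTheorem12 (d : ℕ) (D : Set (EuclideanSpace ℝ (Fin d))) (hD : IsCompact D)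
    (hD' : (interior D).Nonempty) (s : ℝ) (hs : 0 < s) (p : ℝ≥0∞) [Fact (1 ≤ p)] :
    ∃ c : ℝ, 0 < c ∧ ∃ ε₀ : ℝ≥0, 0 < ε₀ ∧ ∀ ε : ℝ≥0, 0 < ε → ε ≤ ε₀ →
      ((Real.exp (c * (ε : ℝ) ^ (-(d : ℝ) / s)) : ℝ) : EReal) ≤
        metricEntropy (lipOne (sobolevUnitBall D s p)) ε := by
  obtain ⟨κ, ρ, r, hκ, hρ, hr, hpack⟩ := exists_separated_sobolevUnitBall hD hD' hs p
  set Y : ℝ := ρ * (κ / 3) ^ (1 / s) with hY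
  have hY0 : 0 < Y := by positivity
  have hlog : 0 < Real.log r := Real.log_pos hr
  -- The constant comes from `r^(M^d)` with `M ≥ X/2` and `X = Y ε^{-1/s}`. The two bounds on `ε`
  -- give `3ε ≤ 1` and `X ≥ 1`.
  refine ⟨Real.log r * (Y / 2) ^ d, by positivity,
    (min (1 / 3) (κ * ρ ^ s / 3)).toNNReal, Real.toNNReal_pos.2 (by positivity), ?_⟩
  intro ε hε hεle
  have hε0 : (0 : ℝ) < ε := hε
  have hεle' : (ε : ℝ) ≤ min (1 / 3) (κ * ρ ^ s / 3) :=
    (Real.le_toNNReal_iff_coe_le (by positivity)).1 hεle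
  have hε1 : (ε : ℝ) ≤ 1 / 3 := hεle'.trans (min_le_left _ _)
  have hε2 : (ε : ℝ) ≤ κ * ρ ^ s / 3 := hεle'.trans (min_le_right _ _)
  -- The solution of `κ (ρ/X)^s = 3ε`; rounding `X` down only increases the separation, which is
  -- used with `t = 3ε`.
  set X : ℝ := ρ * (κ / (3 * ε)) ^ (1 / s) with hX
  have hX0 : 0 < X := by positivity
  have hXs : X ^ s = ρ ^ s * (κ / (3 * ε)) := by
    rw [hX, Real.mul_rpow hρ.le (by positivity), ← Real.rpow_mul (by positivity),
      one_div_mul_cancel hs.ne', Real.rpow_one]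
  have hX1 : 1 ≤ X := by
    refine (Real.rpow_le_rpow_iff zero_le_one hX0.le hs).1 ?_
    rw [Real.one_rpow, hXs, mul_div_assoc', le_div_iff₀ (by positivity)]
    linarith
  have hXY : X = Y * (ε : ℝ) ^ (-(1 / s)) := by
    rw [hX, hY, mul_assoc, Real.rpow_neg hε0.le, ← div_div, Real.div_rpow (by positivity) hε0.le]
    rfl
  set M := ⌊X⌋₊ with hM
  have hM1 : 1 ≤ M := (Nat.one_le_floor_iff X).2 hX1
  have hMX : (M : ℝ) ≤ X := Nat.floor_le hX0.le
  have hM1' : (1 : ℝ) ≤ M := by exact_mod_cast hM1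
  have hXM : X / 2 ≤ M := by
    have : X < M + 1 := Nat.lt_floor_add_one X
    linarith
  obtain ⟨S, hS, hsep⟩ := hpack M hM1
  have hstep : 3 * (ε : ℝ) ≤ κ * (ρ / M) ^ s := by
    calc 3 * (ε : ℝ) = κ * (ρ / X) ^ s := by
          rw [Real.div_rpow hρ.le hX0.le, hXs]
          have : ρ ^ s ≠ 0 := (Real.rpow_pos_of_pos hρ s).ne'
          field_simp
      _ ≤ κ * (ρ / M) ^ s := by gcongr
  have hlt : 2 * ε < 3 * ε := by
    rw [← NNReal.coe_lt_coe]
    push_cast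
    linarith
  have hle : 3 * ε ≤ 1 := by
    rw [← NNReal.coe_le_coe]
    push_cast
    linarith
  refine le_trans ?_ (card_le_metricEntropy_lipOne hlt hle S fun u hu v hv huv => by
    push_cast
    exact hstep.trans (hsep u hu v hv huv))
  rw [EReal.coe_le_coe_iff]
  refine le_trans ?_ hS
  have hpow : (ε : ℝ) ^ (-(d : ℝ) / s) = ((ε : ℝ) ^ (-(1 / s))) ^ d := by
    rw [← Real.rpow_natCast, ← Real.rpow_mul hε0.le]
    congr 1
    ring
  calc Real.exp (Real.log r * (Y / 2) ^ d * (ε : ℝ) ^ (-(d : ℝ) / s))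
      = Real.exp (Real.log r * (X / 2) ^ d) := by
        rw [hpow, mul_assoc, ← mul_pow, hXY]
        congr 3
        ring
    _ ≤ Real.exp (Real.log r * ((M ^ d : ℕ) : ℝ)) := by
        push_cast
        gcongr
    _ = r ^ (M ^ d) := by
        rw [Real.exp_mul, Real.exp_log (by linarith), Real.rpow_natCast]
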